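/- Let $V$ be a finite set of $n$ qubits, let $I,O\subseteq V$ be sets of input and output qubits, and let $|\Psi\rangle\in(\mathbb C^2)^{\otimes V}$ be a normalised resource state. A measurement-based (MBQC) pattern with inputs $I$ and outputs $O$ works as follows. (i) An input state $|\psi\rangle$ on a separate system $S$ of $|I|$ qubits is transferred to the resource by some quantum operation acting jointly on $S$ and $I$ only, given by finitely many Kraus operators $L_k:(\mathbb C^2)^{\otimes S}\otimes(\mathbb C^2)^{\otimes I}\to(\mathbb C^2)^{\otimes I}$ with $\sum_k L_k^\dagger L_k=1$, whose outcome $k$ is recorded. (ii) Then a finite sequence of single-qubit measurements in orthonormal bases and of single-qubit unitary corrections is performed on the qubits of $V$, where each step may depend on all previous outcomes; every measured qubit is discarded, and in the end exactly the qubits of $O$ are left. A branch is a possible sequence of outcomes. The pattern is unitary on $|\Psi\rangle$ if in every branch there are a unitary $U$ on $(\mathbb C^2)^{\otimes I}$ and an isometric encoding $J:(\mathbb C^2)^{\otimes I}\to(\mathbb C^2)^{\otimes O}$ ($U$ and $J$ may depend on the branch, but not on the input) such that, for every input $|\psi\rangle$, the unnormalised output state of the branch is a scalar multiple (possibly zero,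 if the branch does not occur) of $JU|\psi\rangle$. If there exists an MBQC pattern with inputs $I$ and outputs $O$ that is unitary on $|\Psi\rangle$, then $|\Psi\rangle$ is D-Happy: for every bipartition $V=A\sqcup B$ with $I\subseteq A$ and $O\subseteq B$, $$E_{A,B}(|\Psi\rangle)=S(\rho_A)\ \ge\ |I|,$$ where $\rho_A=\operatorname{Tr}_B|\Psi\rangle\langle\Psi|$ and $S(\rho)=-\operatorname{Tr}(\rho\log_2\rho)$ is the von Neumann entropy in bits. -/

import Mathlib

namespace MBQC

/-- Pure (not necessarily normalised) states of a register whose qubits are labelled by `Q`: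
the Hilbert space `(ℂ²)^{⊗ Q}` in its computational basis `Q → Fin 2`. -/
abbrev Reg (Q : Type*) [Fintype Q] [DecidableEq Q] : Type _ :=
  EuclideanSpace ℂ (Q → Fin 2)

section

variable {V : Type*} [Fintype V] [DecidableEq V]

/-- The bit string on `V` that is `x` on `A` and `y` on the complement of `A`. -/
def glue (A : Finset V) (x : ↥A → Fin 2) (y : ↥(Aᶜ) → Fin 2) : V → Fin 2 :=
  fun v => if h : v ∈ A then x ⟨v, h⟩ else y ⟨v, Finset.mem_compl.2 h⟩

/-- The reduced state `ρ_A = Tr_{Aᶜ} |Ψ⟩⟨Ψ|`. -/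
noncomputable def reducedState (Ψ : Reg V) (A : Finset V) :
    Matrix (↥A → Fin 2) (↥A → Fin 2) ℂ :=
  Matrix.of fun x x' => ∑ y : ↥(Aᶜ) → Fin 2, Ψ (glue A x y) * star (Ψ (glue A x' y))

theorem reducedState_isHermitian (Ψ : Reg V) (A : Finset V) :
    (reducedState Ψ A).IsHermitian := by
  ext x x'
  simp [reducedState, Matrix.conjTranspose_apply, mul_comm]

/-- Von Neumann entropy in bits, `S(ρ) = -Tr (ρ log₂ ρ) = -∑ λ log₂ λ` over the eigenvalues `λ` of
`ρ` with multiplicity (and `0 log 0 = 0`). -/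
noncomputable def vonNeumannEntropy {X : Type*} [Fintype X] [DecidableEq X]
    {ρ : Matrix X X ℂ} (hρ : ρ.IsHermitian) : ℝ :=
  -∑ i, hρ.eigenvalues i * Real.logb 2 (hρ.eigenvalues i)

/-- The entropy of entanglement of `Ψ` across the bipartition `A`, `Aᶜ`. -/
noncomputable def entanglementEntropy (Ψ : Reg V) (A : Finset V) : ℝ :=
  vonNeumannEntropy (reducedState_isHermitian Ψ A)

/-- `Ψ` with inputs `I` and outputs `O` is D-Happy: across every bipartition `A`, `B = Aᶜ` with
`I ⊆ A` and `O ⊆ B` the entropy of entanglement is at least `|I|`. -/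
def DHappy (Ψ : Reg V) (I O : Finset V) : Prop :=
  ∀ A : Finset V, I ⊆ A → O ⊆ Aᶜ → (I.card : ℝ) ≤ entanglementEntropy Ψ A

end

section

variable {V : Type*} [DecidableEq V]

/-- The single-qubit operator `M` acting on qubit `v` of the register `R`. -/
noncomputable def localOp {R : Finset V} (v : V) (hv : v ∈ R) (M : Matrix (Fin 2) (Fin 2) ℂ) :
    Reg ↥R →ₗ[ℂ] Reg ↥R where
  toFun φ := WithLp.toLp 2 fun x =>
    ∑ b : Fin 2, M (x ⟨v, hv⟩) b * φ (Function.update x ⟨v, hv⟩ b)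
  map_add' φ φ' := by
    ext x
    simp [mul_add, Finset.sum_add_distrib]
  map_smul' c φ := by
    ext x
    simp [mul_add, mul_left_comm]

/-- The bit string on `R` that is `b` at `v` and `x` elsewhere. -/
def insertBit {R : Finset V} (v : V) (b : Fin 2) (x : ↥(R.erase v) → Fin 2) : ↥R → Fin 2 :=
  fun u => if h : u.1 = v then b else x ⟨u.1, Finset.mem_erase.2 ⟨h, u.2⟩⟩

/-- The (destructive) projection `⟨e|` of qubit `v` of the register `R`; the result is the
unnormalised state of the remaining qubits. -/
noncomputable def projectOut {R : Finset V} (v : V) (e : EuclideanSpace ℂ (Fin 2)) :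
    Reg ↥R →ₗ[ℂ] Reg ↥(R.erase v) where
  toFun φ := WithLp.toLp 2 fun x => ∑ b : Fin 2, star (e b) * φ (insertBit v b x)
  map_add' φ φ' := by
    ext x
    simp [mul_add, Finset.sum_add_distrib]
  map_smul' c φ := by
    ext x
    simp [mul_add, mul_left_comm]

/-- Adaptive programs of one-qubit measurements and one-qubit corrections on the register `R`.
Every measured qubit is removed, and the program stops when exactly the qubits `O` are left.
Everything that follows a measurement may depend on its outcome. -/
inductive Program (O : Finset V) : Finset V → Type _
  /-- Stop; only the output qubits remain. -/
  | done : Program O O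
  /-- Apply the unitary `U` to qubit `v`, then continue. -/
  | correct {R : Finset V} (v : V) (hv : v ∈ R) (U : Matrix.unitaryGroup (Fin 2) ℂ)
      (next : Program O R) : Program O R
  /-- Measure qubit `v` in the orthonormal basis `e`; on outcome `r` continue with `next r`. -/
  | measure {R : Finset V} (v : V) (hv : v ∈ R)
      (e : OrthonormalBasis (Fin 2) ℂ (EuclideanSpace ℂ (Fin 2)))
      (next : Fin 2 → Program O (R.erase v)) : Program O R

/-- The operators of the branches of a program: one for each possible sequence of outcomes, sending
the initial state to the unnormalised final state (squared norm = probability of the branch). -/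
noncomputable def Program.branches {O : Finset V} :
    {R : Finset V} → Program O R → Set (Reg ↥R →ₗ[ℂ] Reg ↥O)
  | _, .done => {LinearMap.id}
  | _, .correct v hv U next => (fun K => K ∘ₗ localOp v hv U.1) '' next.branches
  | _, .measure v _ e next => ⋃ r : Fin 2, (fun K => K ∘ₗ projectOut v (e r)) '' (next r).branches

end

section

variable {V : Type*} [Fintype V] [DecidableEq V]

/-- Insert the input on a system `S` of `|I|` qubits (labelled by `I`) into the resource `Ψ`: apply
the operator `L`, from `S ⊗ I` to `I`, to `ψ_S ⊗ Ψ`. -/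
noncomputable def loadOp (I : Finset V)
    (L : Matrix (↥I → Fin 2) ((↥I → Fin 2) × (↥I → Fin 2)) ℂ) (Ψ : Reg V) :
    Reg ↥I →ₗ[ℂ] Reg ↥(Finset.univ : Finset V) where
  toFun ψ := WithLp.toLp 2 fun x =>
    ∑ s : ↥I → Fin 2, ∑ y : ↥I → Fin 2,
      L (fun i => x ⟨i.1, Finset.mem_univ i.1⟩) (s, y) *
        (ψ s * Ψ (glue I y fun u => x ⟨u.1, Finset.mem_univ u.1⟩))
  map_add' φ φ' := by
    ext x
    simp [mul_add, add_mul, Finset.sum_add_distrib]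
  map_smul' c φ := by
    ext x
    simp [Finset.mul_sum, mul_left_comm, mul_assoc]

/-- A measurement pattern on qubits `V` with inputs `I` and outputs `O`. First the input, on a
separate system `S` of `|I|` qubits, is transferred to the resource by a quantum operation (a
complete family of Kraus operators) acting jointly on `S` and `I` only; then an adaptive
program of one-qubit measurements and corrections, which may depend on the outcome `k` of the first
step, is run until only the qubits `O` are left. -/
structure Pattern (I O : Finset V) where
  /-- The number of outcomes of the input step. -/
  numOutcomes : ℕ
  /-- The Kraus operators of the input step. -/
  load : Fin numOutcomes → Matrix (↥I → Fin 2) ((↥I → Fin 2) × (↥I → Fin 2)) ℂ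
  load_complete : ∑ k, (load k).conjTranspose * load k = 1
  /-- The measurements and corrections after outcome `k` of the input step. -/
  program : Fin numOutcomes → Program O (Finset.univ : Finset V)

/-- The operators of the branches of a pattern run on the resource state `Ψ`, from the input system
to the output qubits. -/
noncomputable def Pattern.branches {I O : Finset V} (P : Pattern I O) (Ψ : Reg V) :
    Set (Reg ↥I →ₗ[ℂ] Reg ↥O) :=
  ⋃ k, (fun K => K ∘ₗ loadOp I (P.load k) Ψ) '' (P.program k).branches

/-- The pattern is unitary on the resource `Ψ`: in every branch there are a unitary `U` of the input
space and an isometric encoding `J` into the output qubits such that every input `ψ` is returned, up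
to a scalar (phase and probability of the branch), as `J (U ψ)`. Both `U` and `J` may depend on the
branch. -/
def Pattern.IsUnitaryOn {I O : Finset V} (P : Pattern I O) (Ψ : Reg V) : Prop :=
  ∀ K ∈ P.branches Ψ, ∃ (U : Reg ↥I ≃ₗᵢ[ℂ] Reg ↥I) (J : Reg ↥I →ₗᵢ[ℂ] Reg ↥O),
    ∀ ψ : Reg ↥I, ∃ c : ℂ, K ψ = c • J (U ψ)

end

end MBQC

/-! Every eigenvalue of `ρ_A` is at most `2^(-|I|)`, so already the min-entropy, and with it the von
Neumann entropy, is at least `|I|`. An eigenvalue `l` is both the overlap with `Ψ` and the squared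
norm of a vector `χ` that is a product across `A | Aᶜ` (`exists_product_of_eigenvalue`), so it
suffices to bound overlaps with product vectors.

Run the pattern on `χ` and on `Ψ`, feeding in half of a maximally entangled state whose other half
is a reference. Summed over branches, overlaps and squared norms are preserved. Load, corrections
and measurements never act across the cut between reference and `A` on one side and `Aᶜ` on the
other, so `χ` ends in every branch as a product of reference and output, since `O ⊆ Aᶜ`. Unitarity
makes `Ψ` end as a multiple of a maximally entangled state, and the overlap of the two is at most
`1/√(2^|I|)` times their norms. Cauchy-Schwarz over the branches
(`Program.sqrt_card_mul_norm_sum_inner_le`) carries this bound back to `χ` and `Ψ`. -/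

namespace MBQC

/-! ### Splitting bit strings at a qubit or along a bipartition. -/

section Bits

variable {V : Type*} [DecidableEq V]

theorem insertBit_self {R : Finset V} {v : V} (hv : v ∈ R) (b : Fin 2)
    (x : ↥(R.erase v) → Fin 2) : insertBit v b x ⟨v, hv⟩ = b := by
  simp [insertBit]

theorem insertBit_of_ne {R : Finset V} {v : V} (b : Fin 2) (x : ↥(R.erase v) → Fin 2)
    (u : ↥R) (h : u.1 ≠ v) : insertBit v b x u = x ⟨u.1, Finset.mem_erase.2 ⟨h, u.2⟩⟩ := by
  simp [insertBit, h]

theorem update_insertBit {R : Finset V} {v : V} (hv : v ∈ R) (b c : Fin 2)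
    (x : ↥(R.erase v) → Fin 2) :
    Function.update (insertBit v b x) ⟨v, hv⟩ c = insertBit v c x := by
  ext u
  by_cases h : u.1 = v
  · obtain rfl : u = ⟨v, hv⟩ := Subtype.ext h
    simp [insertBit_self]
  · rw [Function.update_of_ne (fun h' => h (congrArg Subtype.val h')),
      insertBit_of_ne _ _ _ h, insertBit_of_ne _ _ _ h]

/-- Split the bit at `v` off a bit string on `R`. -/
def insertBitEquiv {R : Finset V} {v : V} (hv : v ∈ R) :
    (↥(R.erase v) → Fin 2) × Fin 2 ≃ (↥R → Fin 2) where
  toFun p := insertBit v p.2 p.1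
  invFun x := (fun u => x ⟨u.1, Finset.mem_of_mem_erase u.2⟩, x ⟨v, hv⟩)
  left_inv p := by
    refine Prod.ext (funext fun u => ?_) (insertBit_self hv _ _)
    exact insertBit_of_ne p.2 p.1 ⟨u.1, Finset.mem_of_mem_erase u.2⟩ (Finset.ne_of_mem_erase u.2)
  right_inv x := by
    ext u
    by_cases h : u.1 = v
    · obtain rfl : u = ⟨v, hv⟩ := Subtype.ext h
      simp [insertBit_self]
    · exact congrArg Fin.val (insertBit_of_ne _ _ u h)

theorem sum_insertBit {R : Finset V} {v : V} (hv : v ∈ R) (f : (↥R → Fin 2) → ℂ) :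
    ∑ x, f x = ∑ x : ↥(R.erase v) → Fin 2, ∑ b, f (insertBit v b x) := by
  rw [← (insertBitEquiv hv).sum_comp, Fintype.sum_prod_type]
  rfl

theorem glue_of_mem [Fintype V] {A : Finset V} (x : ↥A → Fin 2) (y : ↥(Aᶜ) → Fin 2) {v : V}
    (hv : v ∈ A) : glue A x y v = x ⟨v, hv⟩ := by
  simp [glue, hv]

theorem glue_of_notMem [Fintype V] {A : Finset V} (x : ↥A → Fin 2) (y : ↥(Aᶜ) → Fin 2) {v : V}
    (hv : v ∉ A) : glue A x y v = y ⟨v, Finset.mem_compl.2 hv⟩ := by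
  simp [glue, hv]

/-- Split a bit string on `V` into its parts on `A` and on the complement of `A`. -/
def glueEquiv [Fintype V] (A : Finset V) :
    (↥A → Fin 2) × (↥(Aᶜ) → Fin 2) ≃ (V → Fin 2) where
  toFun p := glue A p.1 p.2
  invFun z := (fun v => z v.1, fun v => z v.1)
  left_inv p := Prod.ext (funext fun v => glue_of_mem _ _ v.2)
    (funext fun v => glue_of_notMem _ _ (Finset.mem_compl.1 v.2))
  right_inv z := by
    ext v
    by_cases h : v ∈ A <;> simp [glue, h]

theorem sum_glue [Fintype V] (A : Finset V) {M : Type*} [AddCommMonoid M]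
    (f : (V → Fin 2) → M) : ∑ z, f z = ∑ x, ∑ y, f (glue A x y) := by
  rw [← (glueEquiv A).sum_comp, Fintype.sum_prod_type]
  rfl

theorem sum_univ_subtype [Fintype V] (f : (V → Fin 2) → ℂ) :
    ∑ x : ↥(Finset.univ : Finset V) → Fin 2, f (fun u => x ⟨u, Finset.mem_univ u⟩) =
      ∑ z, f z :=
  Fintype.sum_equiv
    (Equiv.arrowCongr (Equiv.subtypeUnivEquiv fun v => Finset.mem_univ v) (Equiv.refl _))
    _ _ fun _ => rfl

end Bits

/-! ### Total inner products are preserved by each step of a pattern. -/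

section Completeness

theorem inner_reg {Q : Type*} [Fintype Q] [DecidableEq Q] (φ ψ : Reg Q) :
    inner ℂ φ ψ = ∑ x, star (φ x) * ψ x := by
  simp [PiLp.inner_apply, mul_comm]

/-- Serves both the load operators and, with a single Kraus operator, the unitary corrections. -/
theorem sum_star_mulVec_mul {X Y K : Type*} [Fintype X] [Fintype Y] [Fintype K] [DecidableEq Y]
    (L : K → Matrix X Y ℂ) (hL : ∑ k, (L k).conjTranspose * L k = 1) (f g : Y → ℂ) :
    ∑ k, ∑ x, star (∑ y, L k x y * f y) * ∑ y, L k x y * g y = ∑ y, star (f y) * g y := by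
  have h : ∀ k, ∑ x, star (∑ y, L k x y * f y) * ∑ y, L k x y * g y =
      star f ⬝ᵥ (((L k).conjTranspose * L k).mulVec g) := by
    intro k
    rw [← Matrix.mulVec_mulVec, Matrix.dotProduct_mulVec, ← Matrix.star_mulVec]
    rfl
  simp_rw [h]
  rw [← dotProduct_sum, ← Matrix.sum_mulVec, hL, Matrix.one_mulVec]
  rfl

variable {V : Type*} [DecidableEq V]

theorem inner_localOp {R : Finset V} (v : V) (hv : v ∈ R) (U : Matrix.unitaryGroup (Fin 2) ℂ)
    (φ ψ : Reg ↥R) :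
    inner ℂ (localOp v hv U.1 φ) (localOp v hv U.1 ψ) = inner ℂ φ ψ := by
  rw [inner_reg, inner_reg, sum_insertBit hv, sum_insertBit hv]
  refine Finset.sum_congr rfl fun x _ => ?_
  have h := sum_star_mulVec_mul (fun _ : Unit => U.1)
    (by rw [Fintype.sum_unique]; exact Matrix.UnitaryGroup.star_mul_self U)
    (fun b => φ (insertBit v b x)) (fun b => ψ (insertBit v b x))
  rw [Fintype.sum_unique] at h
  rw [← h]
  simp only [localOp, LinearMap.coe_mk, AddHom.coe_mk, update_insertBit, insertBit_self]

/-- Parseval for `e` at qubit `v`, for each fixed setting of the other qubits. -/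
theorem sum_inner_projectOut {R : Finset V} (v : V) (hv : v ∈ R)
    (e : OrthonormalBasis (Fin 2) ℂ (EuclideanSpace ℂ (Fin 2))) (φ ψ : Reg ↥R) :
    ∑ r, inner ℂ (projectOut v (e r) φ) (projectOut v (e r) ψ) = inner ℂ φ ψ := by
  simp_rw [inner_reg]
  rw [Finset.sum_comm, sum_insertBit hv]
  refine Finset.sum_congr rfl fun x _ => ?_
  have h := e.sum_inner_mul_inner (WithLp.toLp 2 fun b => φ (insertBit v b x))
    (WithLp.toLp 2 fun b => ψ (insertBit v b x))
  simp only [PiLp.inner_apply, RCLike.inner_apply'] at h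
  simp only [projectOut, LinearMap.coe_mk, AddHom.coe_mk, star_sum, star_mul', star_star,
    mul_comm (e _ _)]
  simpa only [starRingEnd_apply, mul_comm (e _ _)] using h

theorem sum_inner_loadOp [Fintype V] {I : Finset V} {K : Type*} [Fintype K]
    (L : K → Matrix (↥I → Fin 2) ((↥I → Fin 2) × (↥I → Fin 2)) ℂ)
    (hL : ∑ k, (L k).conjTranspose * L k = 1) (χ Ψ : Reg V) (ψ : Reg ↥I) :
    ∑ k, inner ℂ (loadOp I (L k) χ ψ) (loadOp I (L k) Ψ ψ) =
      inner ℂ ψ ψ * inner ℂ χ Ψ := by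
  have key := fun y : ↥(Iᶜ) → Fin 2 => sum_star_mulVec_mul L hL
    (fun p : (↥I → Fin 2) × (↥I → Fin 2) => ψ p.1 * χ (glue I p.2 y))
    (fun p => ψ p.1 * Ψ (glue I p.2 y))
  have hk : ∀ k, inner ℂ (loadOp I (L k) χ ψ) (loadOp I (L k) Ψ ψ) =
      ∑ y : ↥(Iᶜ) → Fin 2, ∑ x, star (∑ p, L k x p * (ψ p.1 * χ (glue I p.2 y))) *
        ∑ p, L k x p * (ψ p.1 * Ψ (glue I p.2 y)) := by
    intro k
    rw [inner_reg, Finset.sum_comm]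
    have h1 : ∀ Ψ : Reg V, ∀ x, loadOp I (L k) Ψ ψ x =
        ∑ p, L k (fun i => x ⟨i.1, Finset.mem_univ i.1⟩) p *
          (ψ p.1 * Ψ (glue I p.2 fun u => x ⟨u.1, Finset.mem_univ u.1⟩)) := by
      intro Ψ x
      rw [Fintype.sum_prod_type]
      rfl
    simp_rw [h1]
    rw [sum_univ_subtype fun z =>
      star (∑ p, L k (fun i => z i.1) p * (ψ p.1 * χ (glue I p.2 fun u => z u.1))) *
        ∑ p, L k (fun i => z i.1) p * (ψ p.1 * Ψ (glue I p.2 fun u => z u.1)), sum_glue I]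
    refine Finset.sum_congr rfl fun x _ => Finset.sum_congr rfl fun y _ => ?_
    have hx : (fun i : ↥I => glue I x y i.1) = x := funext fun i => glue_of_mem x y i.2
    have hy : (fun i : ↥(Iᶜ) => glue I x y i.1) = y :=
      funext fun i => glue_of_notMem x y (Finset.mem_compl.1 i.2)
    rw [hx, hy]
  simp_rw [hk]
  rw [Finset.sum_comm]
  simp_rw [key]
  simp_rw [inner_reg, Fintype.sum_prod_type, sum_glue I, Finset.sum_mul, Finset.mul_sum]
  rw [Finset.sum_comm]
  refine Finset.sum_congr rfl fun s _ => ?_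
  rw [Finset.sum_comm]
  refine Finset.sum_congr rfl fun x _ => Finset.sum_congr rfl fun y _ => ?_
  rw [star_mul']
  ring

end Completeness

/-! ### Product vectors stay products under load, correction and measurement. -/

section Separable

variable {V : Type*} [DecidableEq V] {ι : Type*}

/-- The family `χ`, as a vector of `ℂ^ι ⊗ Reg R`, is a product vector for the bipartition of
`ι ∪ R` into `ι ∪ (R ∩ A)` and `R \ A`. -/
def IsProductAcross (A : Finset V) {R : Finset V} (χ : ι → Reg ↥R) : Prop :=
  ∃ (α : ι → (↥R → Fin 2) → ℂ) (β : (↥R → Fin 2) → ℂ),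
    (∀ s, DependsOn (α s) {u | u.1 ∈ A}) ∧ DependsOn β {u | u.1 ∉ A} ∧
      ∀ s x, χ s x = α s x * β x

theorem IsProductAcross.localOp {A R : Finset V} {χ : ι → Reg ↥R} (h : IsProductAcross A χ)
    (v : V) (hv : v ∈ R) (M : Matrix (Fin 2) (Fin 2) ℂ) :
    IsProductAcross A fun s => localOp v hv M (χ s) := by
  obtain ⟨α, β, hα, hβ, hχ⟩ := h
  have hupd : ∀ (S : Set ↥R) (x y : ↥R → Fin 2) (b : Fin 2), (∀ i ∈ S, x i = y i) →
      ∀ i ∈ S, Function.update x ⟨v, hv⟩ b i = Function.update y ⟨v, hv⟩ b i := by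
    intro S x y b hxy i hi
    by_cases h : i = ⟨v, hv⟩
    · subst h; simp
    · simp [Function.update_of_ne h, hxy i hi]
  by_cases hA : v ∈ A
  · refine ⟨fun s x => ∑ b, M (x ⟨v, hv⟩) b * α s (Function.update x ⟨v, hv⟩ b), β, ?_, hβ, ?_⟩
    · intro s x y hxy
      refine Finset.sum_congr rfl fun b _ => ?_
      rw [hxy ⟨v, hv⟩ hA, hα s (hupd _ x y b hxy)]
    · intro s x
      simp only [MBQC.localOp, LinearMap.coe_mk, AddHom.coe_mk, hχ, Finset.sum_mul]
      refine Finset.sum_congr rfl fun b _ => ?_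
      rw [hβ (x := Function.update x ⟨v, hv⟩ b) (y := x), mul_assoc]
      intro i hi
      exact Function.update_of_ne (fun h' => hi (by subst h'; exact hA)) _ _
  · refine ⟨α, fun x => ∑ b, M (x ⟨v, hv⟩) b * β (Function.update x ⟨v, hv⟩ b), hα, ?_, ?_⟩
    · intro x y hxy
      refine Finset.sum_congr rfl fun b _ => ?_
      rw [hxy ⟨v, hv⟩ hA, hβ (hupd _ x y b hxy)]
    · intro s x
      simp only [MBQC.localOp, LinearMap.coe_mk, AddHom.coe_mk, hχ, Finset.mul_sum]
      refine Finset.sum_congr rfl fun b _ => ?_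
      rw [hα s (x := Function.update x ⟨v, hv⟩ b) (y := x), mul_left_comm]
      intro i hi
      exact Function.update_of_ne (fun h' => hA (by subst h'; exact hi)) _ _

theorem IsProductAcross.projectOut {A R : Finset V} {χ : ι → Reg ↥R} (h : IsProductAcross A χ)
    (v : V) (e : EuclideanSpace ℂ (Fin 2)) :
    IsProductAcross A fun s => projectOut v e (χ s) := by
  obtain ⟨α, β, hα, hβ, hχ⟩ := h
  have hins : ∀ (S : Set V) (x y : ↥(R.erase v) → Fin 2) (b : Fin 2),
      (∀ i ∈ {u : ↥(R.erase v) | u.1 ∈ S}, x i = y i) →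
      ∀ i ∈ {u : ↥R | u.1 ∈ S}, insertBit v b x i = insertBit v b y i := by
    intro S x y b hxy i hi
    by_cases h : i.1 = v
    · simp [insertBit, h]
    · rw [insertBit_of_ne _ _ _ h, insertBit_of_ne _ _ _ h, hxy _ hi]
  have hbit : ∀ (S : Set V) (x : ↥(R.erase v) → Fin 2) (b : Fin 2), v ∉ S →
      ∀ i ∈ {u : ↥R | u.1 ∈ S}, insertBit v b x i = insertBit v 0 x i := by
    intro S x b hS i hi
    have h : i.1 ≠ v := fun h => hS (h ▸ hi)
    rw [insertBit_of_ne _ _ _ h, insertBit_of_ne _ _ _ h]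
  by_cases hA : v ∈ A
  -- The factor on the side of `v` absorbs `⟨e|`; the other ignores the bit at `v`, so the inserted
  -- `0` is an arbitrary filler.
  · refine ⟨fun s x => ∑ b, star (e b) * α s (insertBit v b x),
      fun x => β (insertBit v 0 x), ?_, ?_, ?_⟩
    · intro s x y hxy
      exact Finset.sum_congr rfl fun b _ => by rw [hα s (hins A x y b hxy)]
    · intro x y hxy
      exact hβ (hins (A : Set V)ᶜ x y 0 hxy)
    · intro s x
      simp only [MBQC.projectOut, LinearMap.coe_mk, AddHom.coe_mk, hχ, Finset.sum_mul]
      refine Finset.sum_congr rfl fun b _ => ?_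
      rw [hβ (hbit (A : Set V)ᶜ x b (fun h => h hA)), mul_assoc]
  · refine ⟨fun s x => α s (insertBit v 0 x),
      fun x => ∑ b, star (e b) * β (insertBit v b x), ?_, ?_, ?_⟩
    · intro s x y hxy
      exact hα s (hins A x y 0 hxy)
    · intro x y hxy
      exact Finset.sum_congr rfl fun b _ => by rw [hβ (hins (A : Set V)ᶜ x y b hxy)]
    · intro s x
      simp only [MBQC.projectOut, LinearMap.coe_mk, AddHom.coe_mk, hχ, Finset.mul_sum]
      refine Finset.sum_congr rfl fun b _ => ?_
      rw [hα s (hbit A x b hA), mul_left_comm]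

/-- As `I ⊆ A`, the load acts on the side of `A` only and leaves the factor `b` untouched. -/
theorem isProductAcross_loadOp [Fintype V] {I A : Finset V} (hIA : I ⊆ A)
    (L : Matrix (↥I → Fin 2) ((↥I → Fin 2) × (↥I → Fin 2)) ℂ)
    (χ : Reg V) (a : (↥A → Fin 2) → ℂ) (b : (↥(Aᶜ) → Fin 2) → ℂ)
    (hχ : ∀ z : V → Fin 2, χ z = a (fun u => z u.1) * b (fun u => z u.1)) (ψ : ι → Reg ↥I) :
    IsProductAcross A fun s => loadOp I L χ (ψ s) := by
  refine ⟨fun s x => ∑ t, ∑ y, L (fun i => x ⟨i.1, Finset.mem_univ i.1⟩) (t, y) *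
      (ψ s t * a (fun u => glue I y (fun u => x ⟨u.1, Finset.mem_univ u.1⟩) u.1)),
    fun x => b (fun u => x ⟨u.1, Finset.mem_univ u.1⟩), ?_, ?_, ?_⟩
  · intro s x y hxy
    have h1 : (fun i : ↥I => x ⟨i.1, Finset.mem_univ i.1⟩) =
        fun i : ↥I => y ⟨i.1, Finset.mem_univ i.1⟩ := funext fun i => hxy _ (hIA i.2)
    simp only [h1]
    refine Finset.sum_congr rfl fun t _ => Finset.sum_congr rfl fun w _ => ?_
    congr 3
    funext u
    by_cases hu : u.1 ∈ I
    · simp [glue, hu]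
    · simpa [glue, hu] using hxy _ u.2
  · intro x y hxy
    exact congrArg b (funext fun u => hxy _ (Finset.mem_compl.1 u.2))
  · intro s x
    simp only [loadOp, LinearMap.coe_mk, AddHom.coe_mk, Finset.sum_mul]
    refine Finset.sum_congr rfl fun t _ => Finset.sum_congr rfl fun w _ => ?_
    have h : (fun u : ↥(Aᶜ) => glue I w (fun u => x ⟨u.1, Finset.mem_univ u.1⟩) u.1) =
        fun u : ↥(Aᶜ) => x ⟨u.1, Finset.mem_univ u.1⟩ :=
      funext fun u => glue_of_notMem _ _ fun hu => Finset.mem_compl.1 u.2 (hIA hu)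
    rw [hχ, h]
    ring

end Separable

/-! ### Overlap of product vectors with a resource carrying a unitary pattern. -/

section Overlap

variable {V : Type*} [DecidableEq V] {ι : Type*} [Fintype ι]

/-- A product vector has overlap at most `1 / √(card ι)` with a maximally entangled one. -/
theorem sqrt_card_mul_norm_sum_inner_le [DecidableEq ι] {F : Type*} [NormedAddCommGroup F]
    [InnerProductSpace ℂ F] (W : EuclideanSpace ℂ ι →ₗᵢ[ℂ] F) (c : ℂ) (a : ι → ℂ) (b : F) :
    √(Fintype.card ι) * ‖∑ s, inner ℂ (a s • b) (c • W (EuclideanSpace.single s 1))‖ ≤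
      √(∑ s, ‖a s • b‖ ^ 2) * √(∑ s, ‖c • W (EuclideanSpace.single s 1)‖ ^ 2) := by
  -- Contracting the reference with `a` leaves one inner product with `W w`; the conjugate comes
  -- from antilinearity in the first slot.
  set w : EuclideanSpace ℂ ι := WithLp.toLp 2 fun s => star (a s) with hw
  have hsum : ∑ s, inner ℂ (a s • b) (c • W (EuclideanSpace.single s 1)) =
      c * inner ℂ b (W w) := by
    have : w = ∑ s, star (a s) • EuclideanSpace.single s (1 : ℂ) := by
      ext t
      simp [hw, Pi.single_apply]
    rw [this, map_sum, inner_sum, Finset.mul_sum]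
    refine Finset.sum_congr rfl fun s _ => ?_
    rw [map_smul, inner_smul_left, inner_smul_right, inner_smul_right]
    simp only [starRingEnd_apply]
    ring
  have h1 : √(∑ s, ‖a s • b‖ ^ 2) = ‖w‖ * ‖b‖ := by
    rw [EuclideanSpace.norm_eq]
    simp_rw [norm_smul, mul_pow]
    rw [← Finset.sum_mul, Real.sqrt_mul (by positivity), Real.sqrt_sq (norm_nonneg _)]
    simp [hw]
  have h2 : √(∑ s, ‖c • W (EuclideanSpace.single s 1)‖ ^ 2) = √(Fintype.card ι) * ‖c‖ := by
    simp [norm_smul]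
  rw [hsum, h1, h2, norm_mul]
  have h3 : ‖inner ℂ b (W w)‖ ≤ ‖w‖ * ‖b‖ := by
    rw [mul_comm]
    simpa using norm_inner_le_norm (𝕜 := ℂ) b (W w)
  calc _ ≤ √(Fintype.card ι) * (‖c‖ * (‖w‖ * ‖b‖)) := by gcongr
    _ = _ := by ring

/-- A quantity that is bounded by `√(p k) * √(q k)` on each branch is bounded by
`√(∑ p) * √(∑ q)` in total. -/
theorem mul_norm_sum_le_sqrt_mul_sqrt {K : Type*} [Fintype K] {C : ℝ} (hC : 0 ≤ C) (z : K → ℂ)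
    (p q : K → ℝ) (hp : ∀ k, 0 ≤ p k) (hq : ∀ k, 0 ≤ q k)
    (h : ∀ k, C * ‖z k‖ ≤ √(p k) * √(q k)) :
    C * ‖∑ k, z k‖ ≤ √(∑ k, p k) * √(∑ k, q k) :=
  calc C * ‖∑ k, z k‖ ≤ C * ∑ k, ‖z k‖ := by gcongr; exact norm_sum_le _ _
    _ = ∑ k, C * ‖z k‖ := Finset.mul_sum _ _ _
    _ ≤ ∑ k, √(p k) * √(q k) := Finset.sum_le_sum fun k _ => h k
    _ ≤ _ := Real.sum_sqrt_mul_sqrt_le _ hp hq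

theorem sum_norm_sq_of_sum_inner {K : Type*} [Fintype K] {G : Type*} [NormedAddCommGroup G]
    [InnerProductSpace ℂ G] {x : K → G} {r : ℝ}
    (h : ∑ k, inner ℂ (x k) (x k) = (r : ℂ)) : ∑ k, ‖x k‖ ^ 2 = r := by
  have : ((∑ k, ‖x k‖ ^ 2 : ℝ) : ℂ) = r := by
    rw [← h]
    push_cast
    exact Finset.sum_congr rfl fun k _ => (inner_self_eq_norm_sq_to_K (x k)).symm
  exact_mod_cast this

theorem Program.sqrt_card_mul_norm_sum_inner_le [DecidableEq ι] {A O : Finset V}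
    (hOA : Disjoint O A) {R : Finset V} (p : Program O R) (χ Φ : ι → Reg ↥R)
    (hχ : IsProductAcross A χ)
    (hΦ : ∀ K ∈ p.branches, ∃ (c : ℂ) (W : EuclideanSpace ℂ ι →ₗᵢ[ℂ] Reg ↥O),
      ∀ s, K (Φ s) = c • W (EuclideanSpace.single s 1)) :
    √(Fintype.card ι) * ‖∑ s, inner ℂ (χ s) (Φ s)‖ ≤
      √(∑ s, ‖χ s‖ ^ 2) * √(∑ s, ‖Φ s‖ ^ 2) := by
  induction p with
  | done =>
    obtain ⟨c, W, hW⟩ := hΦ LinearMap.id rfl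
    obtain ⟨α, β, hα, -, hχ⟩ := hχ
    -- No qubit of `A` is left, so `α s` is constant and may be evaluated at `0`.
    have h : χ = fun s => α s 0 • (WithLp.toLp 2 β : Reg ↥O) := by
      ext s x
      rw [hχ, hα s (x := x) (y := 0)]
      · rfl
      · exact fun i hi => absurd hi (Finset.disjoint_left.1 hOA i.2)
    obtain rfl : Φ = fun s => c • W (EuclideanSpace.single s 1) := funext hW
    rw [h]
    exact MBQC.sqrt_card_mul_norm_sum_inner_le W c (fun s => α s 0) _
  | correct v hv U next ih =>
    have hn : ∀ φ, ‖localOp v hv U.1 φ‖ = ‖φ‖ := by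
      intro φ
      rw [@norm_eq_sqrt_re_inner ℂ, inner_localOp, ← @norm_eq_sqrt_re_inner ℂ]
    have := ih _ (fun s => localOp v hv U.1 (Φ s)) (hχ.localOp v hv U.1)
      fun K hK => hΦ _ ⟨K, hK, rfl⟩
    simpa only [inner_localOp, hn] using this
  | @measure R v hv e next ih =>
    have hn : ∀ φ : Reg ↥R, ∑ r, ‖projectOut v (e r) φ‖ ^ 2 = ‖φ‖ ^ 2 := by
      intro φ
      refine sum_norm_sq_of_sum_inner ?_
      rw [sum_inner_projectOut v hv, inner_self_eq_norm_sq_to_K]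
      norm_cast
    have := mul_norm_sum_le_sqrt_mul_sqrt (Real.sqrt_nonneg _) _ _ _
      (fun r => by positivity) (fun r => by positivity)
      fun r => ih r _ (fun s => projectOut v (e r) (Φ s)) (hχ.projectOut v (e r))
        fun K hK => hΦ _ (Set.mem_iUnion.2 ⟨r, K, hK, rfl⟩)
    -- With the outcome sum moved inside, completeness collapses it in the overlap and in both
    -- norms.
    rw [Finset.sum_comm (s := (Finset.univ : Finset (Fin 2))),
      Finset.sum_comm (s := (Finset.univ : Finset (Fin 2))),
      Finset.sum_comm (s := (Finset.univ : Finset (Fin 2)))] at this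
    simpa only [sum_inner_projectOut v hv, hn] using this

/-- The scalar may a priori vary with the input; linearity at `e_s + e_t` and injectivity of `W`
make it the same for all basis vectors, so that the branch output is a multiple of a maximally
entangled state. -/
theorem exists_smul_of_forall_exists_smul [DecidableEq ι] {F : Type*} [NormedAddCommGroup F]
    [InnerProductSpace ℂ F] (W : EuclideanSpace ℂ ι →ₗᵢ[ℂ] F) (K : EuclideanSpace ℂ ι →ₗ[ℂ] F)
    (h : ∀ ψ, ∃ c : ℂ, K ψ = c • W ψ) :
    ∃ c : ℂ, ∀ s, K (EuclideanSpace.single s 1) = c • W (EuclideanSpace.single s 1) := by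
  choose c hc using h
  have key : ∀ s t, c (EuclideanSpace.single s 1) = c (EuclideanSpace.single t 1) := by
    intro s t
    by_cases hst : s = t
    · rw [hst]
    have h1 := hc (EuclideanSpace.single s 1 + EuclideanSpace.single t 1)
    rw [map_add, hc, hc, ← map_smul, ← map_smul, ← map_smul, ← map_add] at h1
    have h2 := W.injective h1
    have hs := congrArg (fun w : EuclideanSpace ℂ ι => w s) h2
    have ht := congrArg (fun w : EuclideanSpace ℂ ι => w t) h2
    simp [hst, Ne.symm hst] at hs ht
    rw [hs, ht]
  rcases isEmpty_or_nonempty ι with h0 | ⟨⟨t⟩⟩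
  · exact ⟨0, fun s => h0.elim s⟩
  · exact ⟨_, fun s => (hc _).trans (by rw [key s t])⟩

/-- The overlap of a resource that carries a unitary pattern with a product vector. -/
theorem Pattern.IsUnitaryOn.sqrt_card_mul_norm_inner_le [Fintype V] {I O A : Finset V}
    {P : Pattern I O} {Ψ : Reg V} (hP : P.IsUnitaryOn Ψ) (hIA : I ⊆ A) (hOA : O ⊆ Aᶜ)
    (χ : Reg V) (a : (↥A → Fin 2) → ℂ) (b : (↥(Aᶜ) → Fin 2) → ℂ)
    (hχ : ∀ z : V → Fin 2, χ z = a (fun u => z u.1) * b (fun u => z u.1)) :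
    √(2 ^ I.card) * ‖inner ℂ χ Ψ‖ ≤ ‖χ‖ * ‖Ψ‖ := by
  -- This family is the unnormalised maximally entangled state of reference and input.
  set E : (↥I → Fin 2) → Reg ↥I := fun s => EuclideanSpace.single s 1 with hE
  have hdisj : Disjoint O A :=
    Finset.disjoint_left.2 fun v hv => Finset.mem_compl.1 (hOA hv)
  have hin : ∀ (χ Ψ : Reg V) s, ∑ k, inner ℂ (loadOp I (P.load k) χ (E s))
      (loadOp I (P.load k) Ψ (E s)) = inner ℂ χ Ψ := by
    intro χ Ψ s
    rw [sum_inner_loadOp P.load P.load_complete]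
    simp [hE, inner_self_eq_norm_sq_to_K]
  have hn : ∀ (χ : Reg V) s, ∑ k, ‖loadOp I (P.load k) χ (E s)‖ ^ 2 = ‖χ‖ ^ 2 := by
    intro χ s
    refine sum_norm_sq_of_sum_inner ?_
    rw [hin, inner_self_eq_norm_sq_to_K]
    norm_cast
  have h := mul_norm_sum_le_sqrt_mul_sqrt (Real.sqrt_nonneg _) _ _ _
    (fun r => by positivity) (fun r => by positivity)
    fun k => (P.program k).sqrt_card_mul_norm_sum_inner_le hdisj _
      (fun s => loadOp I (P.load k) Ψ (E s))
      (isProductAcross_loadOp hIA (P.load k) χ a b hχ E) (by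
        intro K hK
        obtain ⟨U, J, hJ⟩ := hP _ (Set.mem_iUnion.2 ⟨k, K, hK, rfl⟩)
        obtain ⟨c, hc⟩ := exists_smul_of_forall_exists_smul (J.comp U.toLinearIsometry) _ hJ
        exact ⟨c, _, hc⟩)
  rw [Finset.sum_comm (s := (Finset.univ : Finset (Fin P.numOutcomes))),
    Finset.sum_comm (s := (Finset.univ : Finset (Fin P.numOutcomes))),
    Finset.sum_comm (s := (Finset.univ : Finset (Fin P.numOutcomes)))] at h
  simp only [hin, hn, Finset.sum_const, Finset.card_univ, nsmul_eq_mul, norm_mul,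
    Fintype.card_fun, Fintype.card_fin, Fintype.card_coe, Nat.cast_pow,
    Nat.cast_ofNat] at h
  rw [Real.sqrt_mul (by positivity), Real.sqrt_mul (by positivity), Real.sqrt_sq (norm_nonneg _),
    Real.sqrt_sq (norm_nonneg _), norm_pow] at h
  have h2 : (0 : ℝ) < 2 ^ I.card := by positivity
  have h3 : √((2 : ℝ) ^ I.card) * √(2 ^ I.card) = 2 ^ I.card := Real.mul_self_sqrt h2.le
  -- All `2^|I|` inputs contribute equally; the resulting factor `2^|I|` on both sides cancels.
  refine le_of_mul_le_mul_left ?_ h2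
  calc _ = √(2 ^ I.card) * (2 ^ I.card * ‖inner ℂ χ Ψ‖) := by ring
    _ ≤ √(2 ^ I.card) * ‖χ‖ * (√(2 ^ I.card) * ‖Ψ‖) := by simpa using h
    _ = √(2 ^ I.card) * √(2 ^ I.card) * (‖χ‖ * ‖Ψ‖) := by ring
    _ = _ := by rw [h3]

end Overlap

/-! ### From eigenvalue bounds to entropy, and product vectors from eigenvectors. -/

section Entropy

/-- The von Neumann entropy of a density matrix is at least its min-entropy. -/
theorem le_vonNeumannEntropy {X : Type*} [Fintype X] [DecidableEq X] {ρ : Matrix X X ℂ}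
    (hρ : ρ.IsHermitian) (htr : ρ.trace = 1) (n : ℕ) (h0 : ∀ i, 0 ≤ hρ.eigenvalues i)
    (h : ∀ i, 2 ^ n * hρ.eigenvalues i ≤ 1) : (n : ℝ) ≤ vonNeumannEntropy hρ := by
  have hsum : ∑ i, hρ.eigenvalues i = 1 := by
    have := hρ.trace_eq_sum_eigenvalues
    rw [htr] at this
    have h' : ((∑ i, hρ.eigenvalues i : ℝ) : ℂ) = 1 := by simpa using this.symm
    exact_mod_cast h'
  have key : ∀ i, hρ.eigenvalues i * n ≤ -(hρ.eigenvalues i * Real.logb 2 (hρ.eigenvalues i)) := by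
    intro i
    rcases (h0 i).eq_or_lt with h1 | h1
    · simp [← h1]
    · rw [← mul_neg]
      refine mul_le_mul_of_nonneg_left ?_ (h0 i)
      have h2 := Real.logb_le_logb_of_le (b := 2) one_lt_two (by positivity) (h i)
      rw [Real.logb_one, Real.logb_mul (by positivity) h1.ne', Real.logb_pow,
        Real.logb_self_eq_one one_lt_two] at h2
      linarith
  calc (n : ℝ) = ∑ i, hρ.eigenvalues i * n := by rw [← Finset.sum_mul, hsum, one_mul]
    _ ≤ _ := Finset.sum_le_sum fun i _ => key i
    _ = _ := Finset.sum_neg_distrib _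

variable {V : Type*} [Fintype V] [DecidableEq V]

theorem trace_reducedState (Ψ : Reg V) (A : Finset V) :
    (reducedState Ψ A).trace = (‖Ψ‖ ^ 2 : ℝ) := by
  have : inner ℂ Ψ Ψ = ((‖Ψ‖ ^ 2 : ℝ) : ℂ) := by
    rw [inner_self_eq_norm_sq_to_K]
    norm_cast
  rw [← this, inner_reg, sum_glue A]
  simp only [Matrix.trace, Matrix.diag, reducedState, Matrix.of_apply, mul_comm]

/-- Each Schmidt coefficient is attained by a product vector: an eigenvalue `l` of the reduced state
is both the squared norm of a product vector and its overlap with the state. -/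
theorem exists_product_of_eigenvalue (Ψ : Reg V) (A : Finset V) (i : ↥A → Fin 2) :
    ∃ (χ : Reg V) (a : (↥A → Fin 2) → ℂ) (b : (↥(Aᶜ) → Fin 2) → ℂ),
      (∀ z : V → Fin 2, χ z = a (fun u => z u.1) * b (fun u => z u.1)) ∧
      ‖χ‖ ^ 2 = (reducedState_isHermitian Ψ A).eigenvalues i ∧
      inner ℂ χ Ψ = (reducedState_isHermitian Ψ A).eigenvalues i := by
  set hρ := reducedState_isHermitian Ψ A
  set a : EuclideanSpace ℂ (↥A → Fin 2) := hρ.eigenvectorBasis i with ha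
  -- Then `a ⊗ b` is the orthogonal projection `(|a⟩⟨a| ⊗ 1) Ψ`, so its squared norm equals its
  -- overlap with `Ψ`.
  set b : (↥(Aᶜ) → Fin 2) → ℂ := fun y => ∑ x, star (a x) * Ψ (glue A x y) with hb
  have hnorm : ∑ x, star (a x) * a x = 1 := by
    have h : inner ℂ a a = (1 : ℂ) := by
      rw [inner_self_eq_norm_sq_to_K, ha, hρ.eigenvectorBasis.orthonormal.1 i]
      simp
    rw [← h, PiLp.inner_apply]
    exact Finset.sum_congr rfl fun x _ => mul_comm _ _
  have hval : (hρ.eigenvalues i : ℂ) = ∑ y, star (b y) * b y := by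
    have h := congrFun (hρ.mulVec_eigenvectorBasis i)
    have h1 : ∀ x, ∑ x', reducedState Ψ A x x' * a x' = hρ.eigenvalues i * a x := by
      intro x
      simpa [Matrix.mulVec, dotProduct] using h x
    have h2 : ∀ x, ∑ y, Ψ (glue A x y) * star (b y) = hρ.eigenvalues i * a x := by
      intro x
      rw [← h1]
      simp only [hb, reducedState, Matrix.of_apply, star_sum, Finset.mul_sum, Finset.sum_mul]
      rw [Finset.sum_comm]
      refine Finset.sum_congr rfl fun x' _ => Finset.sum_congr rfl fun y _ => ?_
      rw [star_mul', star_star]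
      ring
    calc (hρ.eigenvalues i : ℂ)
        = ∑ x, star (a x) * (hρ.eigenvalues i * a x) := by
          simp_rw [mul_left_comm _ (hρ.eigenvalues i : ℂ)]
          rw [← Finset.mul_sum, hnorm, mul_one]
      _ = ∑ y, b y * star (b y) := by
          simp_rw [← h2, Finset.mul_sum]
          rw [Finset.sum_comm]
          refine Finset.sum_congr rfl fun y _ => ?_
          conv_rhs => rw [hb, Finset.sum_mul]
          exact Finset.sum_congr rfl fun x _ => (mul_assoc _ _ _).symm
      _ = ∑ y, star (b y) * b y := Finset.sum_congr rfl fun y _ => mul_comm _ _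
  have hg : ∀ x y, (fun u : ↥A => glue A x y u.1) = x ∧ (fun u : ↥(Aᶜ) => glue A x y u.1) = y :=
    fun x y => ⟨funext fun u => glue_of_mem x y u.2,
      funext fun u => glue_of_notMem x y (Finset.mem_compl.1 u.2)⟩
  refine ⟨WithLp.toLp 2 fun z => a (fun u => z u.1) * b (fun u => z u.1), a, b,
    fun z => rfl, ?_, ?_⟩
  · have h : ((‖(WithLp.toLp 2 fun z => a (fun u => z u.1) * b (fun u => z u.1) : Reg V)‖ ^ 2 : ℝ) : ℂ)
        = hρ.eigenvalues i := by
      have := inner_self_eq_norm_sq_to_K (𝕜 := ℂ)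
        (WithLp.toLp 2 fun z => a (fun u => z u.1) * b (fun u => z u.1) : Reg V)
      push_cast
      refine this.symm.trans ?_
      rw [inner_reg, sum_glue A, hval, ← one_mul (∑ y, star (b y) * b y), ← hnorm,
        Finset.sum_mul_sum]
      refine Finset.sum_congr rfl fun x _ => Finset.sum_congr rfl fun y _ => ?_
      simp only [(hg x y).1, (hg x y).2, star_mul']
      ring
    exact_mod_cast h
  · rw [inner_reg, sum_glue A, hval, Finset.sum_comm]
    refine Finset.sum_congr rfl fun y _ => ?_
    conv_rhs => rw [hb]
    rw [Finset.mul_sum]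
    refine Finset.sum_congr rfl fun x _ => ?_
    simp only [(hg x y).1, (hg x y).2, star_mul']
    ring

end Entropy

end MBQC

theorem mainTheorem3 {V : Type*} [Fintype V] [DecidableEq V] (I O : Finset V)
    (Ψ : MBQC.Reg V) (hΨ : ‖Ψ‖ = 1)
    (hP : ∃ P : MBQC.Pattern I O, P.IsUnitaryOn Ψ) :
    MBQC.DHappy Ψ I O := by
  obtain ⟨P, hP⟩ := hP
  intro A hIA hOA
  have hev : ∀ i, 0 ≤ (MBQC.reducedState_isHermitian Ψ A).eigenvalues i ∧
      2 ^ I.card * (MBQC.reducedState_isHermitian Ψ A).eigenvalues i ≤ 1 := by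
    intro i
    obtain ⟨χ, a, b, hχ, hn, hin⟩ := MBQC.exists_product_of_eigenvalue Ψ A i
    have h := hP.sqrt_card_mul_norm_inner_le hIA hOA χ a b hχ
    set l := (MBQC.reducedState_isHermitian Ψ A).eigenvalues i
    have h0 : 0 ≤ l := hn ▸ sq_nonneg _
    refine ⟨h0, ?_⟩
    rw [hin, hΨ, mul_one, Complex.norm_real, Real.norm_of_nonneg h0] at h
    rcases h0.eq_or_lt with h1 | h1
    · simp [← h1]
    -- Squaring gives `2^|I| * l^2 ≤ ‖χ‖^2 = l`; then divide by `l > 0`.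
    · have h2 := pow_le_pow_left₀ (by positivity) h 2
      rw [mul_pow, Real.sq_sqrt (by positivity), hn] at h2
      refine le_of_mul_le_mul_right ?_ h1
      linarith
  refine MBQC.le_vonNeumannEntropy _ ?_ _ (fun i => (hev i).1) fun i => (hev i).2
  rw [MBQC.trace_reducedState, hΨ]
  simp
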